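/- Let $(X,\mathcal B,\mu)$ be a standard Borel probability space and let $L_p=L_p(X,\mu;\mathbb C)$. A $C_0$-group on $L_2$ is a family $(U_t)_{t\in\mathbb R}$ of bounded linear operators on $L_2$ with $U_0=I$, $U_{s+t}=U_sU_t$ for all $s,t\in\mathbb R$, and $t\mapsto U_tf$ continuous for every $f\in L_2$; it is unitary if every $U_t$ is unitary. Its generator is the operator $A$ with domain $D(A)=\{f\in L_2:\lim_{t\to0}\frac1t(U_tf-f)\text{ exists in }L_2\}$ and $Af=\lim_{t\to0}\frac1t(U_tf-f)$. It preserves $L_\infty$ if $U_tL_\infty\subset L_\infty$ for all $t\in\mathbb R$. It is called a weighted Koopman group if for every $t\in\mathbb R$ there exist a measurable, measure-preserving map $T_t\colon X\to X$ and a function $\psi_t\colon X\to\mathbb C$ such that $U_tf=\psi_t\cdot(f\circ T_t)$ a.e. for all $f\in L_2$. **Theorem.** Let $U=(U_t)_{t\in\mathbb R}$ be a unitary $C_0$-group on $L_2$ preserving $L_\infty$. Then the following are equivalent. 1. $U$ is a weighted Koopman group. 2. For all $t\in\mathbb R$ one has $|U_t\mathbf 1|=1$ a.e. Moreover, the operators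 $V_t$ given by $V_tf=\overline{U_t\mathbf 1}\cdot U_tf$ for all $f\in L_2$ form a unitary $C_0$-group $V=(V_t)_{t\in\mathbb R}$ on $L_2$. In addition, if $B$ denotes the generator of $V$, then $D(B)\cap L_\infty$ is an algebra (that is, closed under pointwise multiplication), and $B$ is a derivation on it: $B(fg)=(Bf)\,g+f\,(Bg)$ for all $f,g\in D(B)\cap L_\infty$. -/

import Mathlib

open MeasureTheory Filter Topology
open scoped ENNReal

/-! ### One-parameter `C₀`-groups and their generators -/

section C0Group

/-- A one-parameter `C₀`-group of bounded operators: a strongly continuous representation of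
`(ℝ, +)` on a Banach space. -/
structure IsC0Group {H : Type*} [NormedAddCommGroup H] [NormedSpace ℂ H]
    (U : ℝ → H →L[ℂ] H) : Prop where
  map_zero : U 0 = ContinuousLinearMap.id ℂ H
  map_add : ∀ s t : ℝ, U (s + t) = (U s).comp (U t)
  continuous_orbit : ∀ f : H, Continuous fun t : ℝ => U t f

/-- A unitary `C₀`-group on a Hilbert space. -/
structure IsUnitaryC0Group {H : Type*} [NormedAddCommGroup H] [InnerProductSpace ℂ H]
    [CompleteSpace H] (U : ℝ → H →L[ℂ] H) : Prop extends IsC0Group U where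
  unitary_mem : ∀ t : ℝ, U t ∈ unitary (H →L[ℂ] H)

/-- `g = lim_{t → 0} t⁻¹ (U_t f - f)`, i.e. `(f, g)` lies in the graph of the generator. -/
def HasGeneratorAt {H : Type*} [NormedAddCommGroup H] [NormedSpace ℂ H]
    (U : ℝ → H →L[ℂ] H) (f g : H) : Prop :=
  Tendsto (fun t : ℝ => ((t : ℂ)⁻¹) • (U t f - f)) (𝓝[≠] 0) (𝓝 g)

theorem HasGeneratorAt.unique {H : Type*} [NormedAddCommGroup H] [NormedSpace ℂ H]
    {U : ℝ → H →L[ℂ] H} {f g g' : H} (h : HasGeneratorAt U f g) (h' : HasGeneratorAt U f g') :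
    g = g' :=
  tendsto_nhds_unique h h'

theorem HasGeneratorAt.add {H : Type*} [NormedAddCommGroup H] [NormedSpace ℂ H]
    {U : ℝ → H →L[ℂ] H} {f g f' g' : H} (h : HasGeneratorAt U f g) (h' : HasGeneratorAt U f' g') :
    HasGeneratorAt U (f + f') (g + g') := by
  refine (Tendsto.add h h').congr fun t => ?_
  rw [← smul_add, map_add]
  congr 1
  abel

theorem HasGeneratorAt.smul {H : Type*} [NormedAddCommGroup H] [NormedSpace ℂ H]
    {U : ℝ → H →L[ℂ] H} {f g : H} (c : ℂ) (h : HasGeneratorAt U f g) :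
    HasGeneratorAt U (c • f) (c • g) := by
  refine (Tendsto.const_smul h c).congr fun t => ?_
  rw [map_smul, ← smul_sub, smul_comm]

/-- The (infinitesimal) generator `A` of a one-parameter group `U`, as a partially defined linear
operator: `D(A)` consists of all `f` for which `A f = lim_{t → 0} t⁻¹ (U_t f - f)` exists. -/
noncomputable def groupGenerator {H : Type*} [NormedAddCommGroup H] [NormedSpace ℂ H]
    (U : ℝ → H →L[ℂ] H) : H →ₗ.[ℂ] H where
  domain :=
    { carrier := {f | ∃ g, HasGeneratorAt U f g}
      add_mem' := fun ⟨_, h⟩ ⟨_, h'⟩ => ⟨_, h.add h'⟩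
      zero_mem' := ⟨0, by simp [HasGeneratorAt]⟩
      smul_mem' := fun c _ ⟨_, h⟩ => ⟨_, h.smul c⟩ }
  toFun :=
    { toFun := fun f => f.2.choose
      map_add' := fun f f' =>
        (f + f').2.choose_spec.unique (f.2.choose_spec.add f'.2.choose_spec)
      map_smul' := fun c f => (c • f).2.choose_spec.unique (f.2.choose_spec.smul c) }

theorem mem_groupGenerator_domain {H : Type*} [NormedAddCommGroup H] [NormedSpace ℂ H]
    {U : ℝ → H →L[ℂ] H} {f : H} :
    f ∈ (groupGenerator U).domain ↔ ∃ g, HasGeneratorAt U f g :=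
  Iff.rfl

theorem hasGeneratorAt_groupGenerator {H : Type*} [NormedAddCommGroup H] [NormedSpace ℂ H]
    {U : ℝ → H →L[ℂ] H} (f : (groupGenerator U).domain) :
    HasGeneratorAt U f (groupGenerator U f) :=
  f.2.choose_spec

end C0Group

/-! ### Bounded functions, algebras and derivations in `L₂` -/

section Derivation

/-- `L₂ ∩ L_∞`, as a linear subspace of `L₂`. It is all of `L_∞` if the measure is finite. -/
def boundedL2 {X : Type*} [MeasurableSpace X] (μ : Measure X) : Submodule ℂ (Lp ℂ 2 μ) where
  carrier := {f | MemLp f ∞ μ}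
  add_mem' := fun {f g} hf hg => (memLp_congr_ae (Lp.coeFn_add f g)).2 (MemLp.add hf hg)
  zero_mem' := (memLp_congr_ae (Lp.coeFn_zero ℂ 2 μ)).2 MemLp.zero
  smul_mem' := fun c f hf => (memLp_congr_ae (Lp.coeFn_smul c f)).2 (MemLp.const_smul hf c)

/-- The operators `U_t` leave `L_∞` invariant. -/
def PreservesLInfty {X : Type*} [MeasurableSpace X] {μ : Measure X}
    (U : ℝ → Lp ℂ 2 μ →L[ℂ] Lp ℂ 2 μ) : Prop :=
  ∀ t : ℝ, ∀ f ∈ boundedL2 μ, U t f ∈ boundedL2 μ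

/-- A linear subspace of `L₂` is an algebra if it is closed under pointwise multiplication. -/
def IsFunctionAlgebra {X : Type*} [MeasurableSpace X] {μ : Measure X}
    (𝒟 : Submodule ℂ (Lp ℂ 2 μ)) : Prop :=
  ∀ f ∈ 𝒟, ∀ g ∈ 𝒟, ∃ h ∈ 𝒟, h =ᵐ[μ] fun x => f x * g x

/-- The operator `A` in `L₂` is a derivation on `𝒟 ⊆ D(A)`: one has
`A (f g) = (A f) g + f (A g)` for all `f, g ∈ 𝒟`. Here `h` is the product `f g`, which belongs to
`𝒟` when `𝒟` is an algebra. -/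
def IsDerivationOn {X : Type*} [MeasurableSpace X] {μ : Measure X}
    (A : Lp ℂ 2 μ →ₗ.[ℂ] Lp ℂ 2 μ) (𝒟 : Submodule ℂ (Lp ℂ 2 μ)) : Prop :=
  𝒟 ≤ A.domain ∧
    ∀ f g h : A.domain, (f : Lp ℂ 2 μ) ∈ 𝒟 → (g : Lp ℂ 2 μ) ∈ 𝒟 → (h : Lp ℂ 2 μ) ∈ 𝒟 →
      ((h : Lp ℂ 2 μ) =ᵐ[μ] fun x => (f : Lp ℂ 2 μ) x * (g : Lp ℂ 2 μ) x) →
      A h =ᵐ[μ] fun x => A f x * (g : Lp ℂ 2 μ) x + (f : Lp ℂ 2 μ) x * A g x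

end Derivation

/-! ### Weighted non-singular groups and weighted Koopman groups -/

section Weighted

/-- `U_t f = ψ_t · (f ∘ T_t)` a.e. for all `t` and all `f ∈ L₂`, for every representative `f` of an
element of `L₂`. No measurability of `T_t` and `ψ_t` is required. -/
def IsWeightedComposition {X : Type*} [MeasurableSpace X] {μ : Measure X}
    (U : ℝ → Lp ℂ 2 μ →L[ℂ] Lp ℂ 2 μ) (T : ℝ → X → X) (ψ : ℝ → X → ℂ) : Prop :=
  ∀ (t : ℝ) (f : X → ℂ) (hf : MemLp f 2 μ),
    U t (hf.toLp f) =ᵐ[μ] fun x => ψ t x * f (T t x)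

/-- A weighted Koopman group: a group of the form `U_t f = ψ_t · (f ∘ T_t)` in which every `T_t`
is measure-preserving. -/
def IsWeightedKoopman {X : Type*} [MeasurableSpace X] {μ : Measure X}
    (U : ℝ → Lp ℂ 2 μ →L[ℂ] Lp ℂ 2 μ) : Prop :=
  ∃ (T : ℝ → X → X) (ψ : ℝ → X → ℂ),
    IsWeightedComposition U T ψ ∧ ∀ t : ℝ, MeasurePreserving (T t) μ μ

end Weighted

/-! Write `K_φ f = f ∘ φ`. If `U` is a weighted Koopman group, applying `U_t` to `1` shows `ψ_t =
U_t 1`, and the group law at `1` becomes the cocycle identity `ψ_{s+t} = ψ_s · (ψ_t ∘ T_s)`. As `ψ_0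
= 1`, the weights vanish almost nowhere, so they cancel from the group law and the `K_{T_t}` form a
group. These are then surjective isometries, so multiplication by `ψ_t` is isometric and `|ψ_t| = 1`
(`ae_norm_eq_one_of_isometric`). Hence `V_t = K_{T_t}`, and differentiating `V_t (f g) = V_t f · V_t
g` at `t = 0` gives the derivation property.

Conversely, the derivation property is integrated: for bounded `f, g ∈ D(B)` the function `s ↦
V_{-s} (V_s f · V_s g)` has derivative zero, so `V_t` is multiplicative
(`PreservesLInfty.map_mulL_of_isDerivationOn`). A multiplicative isometry fixing `1` sends
idempotents, that is indicators, to indicators; on a standard Borel space the induced map of sets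
comes from a measure-preserving point map (`exists_measurePreserving_of_isMultiplicativeL2`).

Both product rules face the obstacle that multiplication is not continuous on `L₂`. It is, once one
factor stays bounded in `L_∞` (`tendsto_mulL`). For Koopman operators such a bound is immediate; in
the converse it comes from Baire's theorem and the closed graph theorem
(`PreservesLInfty.eventually_norm_le`), and the same bound makes `D(B) ∩ L_∞` dense
(`PreservesLInfty.dense_domain`). -/

/-! ### Multiplication of `L₂`-functions by bounded functions -/

section BoundedMultiplication

variable {X : Type*} [MeasurableSpace X] {μ : Measure X}

/-- Pointwise multiplication `L_∞ × L₂ → L₂`. -/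
noncomputable def mulL (μ : Measure X) : Lp ℂ ∞ μ →L[ℂ] Lp ℂ 2 μ →L[ℂ] Lp ℂ 2 μ :=
  (ContinuousLinearMap.mul ℂ ℂ).holderL μ ∞ 2 2

theorem coeFn_mulL (b : Lp ℂ ∞ μ) (u : Lp ℂ 2 μ) : mulL μ b u =ᵐ[μ] fun x => b x * u x :=
  (ContinuousLinearMap.mul ℂ ℂ).coeFn_holder b u

theorem norm_mulL_le (b : Lp ℂ ∞ μ) (u : Lp ℂ 2 μ) : ‖mulL μ b u‖ ≤ ‖b‖ * ‖u‖ := by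
  have h := (ContinuousLinearMap.mul ℂ ℂ).norm_holder_apply_apply_le (r := 2) b u
  rw [ContinuousLinearMap.opNorm_mul, one_mul] at h
  exact h

theorem ae_norm_le_norm_linfty (b : Lp ℂ ∞ μ) : ∀ᵐ x ∂μ, ‖b x‖ ≤ ‖b‖ := by
  have h := ae_le_eLpNormEssSup (f := b) (μ := μ)
  filter_upwards [h] with x hx
  rw [Lp.norm_def, eLpNorm_exponent_top, ← toReal_enorm]
  refine ENNReal.toReal_mono ?_ hx
  rw [← eLpNorm_exponent_top]
  exact Lp.eLpNorm_ne_top b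

/-- The functions in `L₂` that are bounded by `C`. -/
def boundedBy (μ : Measure X) (C : ℝ) : Set (Lp ℂ 2 μ) := {u | ∀ᵐ x ∂μ, ‖u x‖ ≤ C}

theorem boundedBy_subset_boundedL2 {C : ℝ} : boundedBy μ C ⊆ boundedL2 μ := fun u hu =>
  memLp_top_of_bound (Lp.aestronglyMeasurable u) C hu

/-- An `L₂`-convergent sequence has an a.e. convergent subsequence, along which the pointwise bound
survives. Closedness in the `L₂`-norm is what Baire's theorem and the averaging of orbits need. -/
theorem isClosed_boundedBy (C : ℝ) : IsClosed (boundedBy μ C) := by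
  refine IsSeqClosed.isClosed fun u v hu hv => ?_
  obtain ⟨ns, -, hns⟩ := (tendstoInMeasure_of_tendsto_Lp hv).exists_seq_tendsto_ae
  have h : ∀ᵐ x ∂μ, ∀ n, ‖u n x‖ ≤ C := ae_all_iff.2 hu
  filter_upwards [hns, h] with x h1 h2
  exact le_of_tendsto h1.norm (Eventually.of_forall fun n => h2 _)

theorem convex_boundedBy (C : ℝ) : Convex ℝ (boundedBy μ C) := by
  intro u hu v hv a b ha hb hab
  filter_upwards [hu, hv, Lp.coeFn_add (a • u) (b • v), Lp.coeFn_smul a u, Lp.coeFn_smul b v]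
    with x h1 h2 h3 h4 h5
  rw [h3, Pi.add_apply, h4, h5, Pi.smul_apply, Pi.smul_apply]
  have h := convex_closedBall (0 : ℂ) C (mem_closedBall_zero_iff.2 h1)
    (mem_closedBall_zero_iff.2 h2) ha hb hab
  exact mem_closedBall_zero_iff.1 h

variable [IsFiniteMeasure μ]

/-- The embedding of `L_∞` into `L₂`. -/
noncomputable def ofLinfty (μ : Measure X) [IsFiniteMeasure μ] : Lp ℂ ∞ μ →L[ℂ] Lp ℂ 2 μ :=
  (mulL μ).flip (Lp.const 2 μ (1 : ℂ))

theorem coeFn_ofLinfty (b : Lp ℂ ∞ μ) : ofLinfty μ b =ᵐ[μ] b := by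
  filter_upwards [coeFn_mulL b (Lp.const 2 μ (1 : ℂ)), Lp.coeFn_const (p := 2) (μ := μ) (1 : ℂ)]
    with x hx h1
  change (mulL μ b (Lp.const 2 μ (1 : ℂ))) x = _
  rw [hx, h1, Function.const_apply, mul_one]

theorem ofLinfty_injective : Function.Injective (ofLinfty μ) := fun b c h =>
  Lp.ext <| (coeFn_ofLinfty b).symm.trans <| h ▸ coeFn_ofLinfty c

theorem mulL_ofLinfty_comm (b c : Lp ℂ ∞ μ) : mulL μ b (ofLinfty μ c) = mulL μ c (ofLinfty μ b) := by
  apply Lp.ext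
  filter_upwards [coeFn_mulL b (ofLinfty μ c), coeFn_mulL c (ofLinfty μ b), coeFn_ofLinfty b,
    coeFn_ofLinfty c] with x h1 h2 h3 h4
  rw [h1, h2, h3, h4, mul_comm]

theorem ofLinfty_mem_boundedL2 (b : Lp ℂ ∞ μ) : ofLinfty μ b ∈ boundedL2 μ :=
  (memLp_congr_ae (coeFn_ofLinfty b)).2 (Lp.memLp b)

theorem mem_boundedL2_iff {f : Lp ℂ 2 μ} : f ∈ boundedL2 μ ↔ ∃ b, ofLinfty μ b = f := by
  constructor
  · intro hf
    have hf' : MemLp f ∞ μ := hf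
    exact ⟨hf'.toLp f, Lp.ext ((coeFn_ofLinfty _).trans hf'.coeFn_toLp)⟩
  · rintro ⟨b, rfl⟩
    exact ofLinfty_mem_boundedL2 b

theorem mulL_mem_boundedL2 (b : Lp ℂ ∞ μ) {u : Lp ℂ 2 μ} (hu : u ∈ boundedL2 μ) :
    mulL μ b u ∈ boundedL2 μ := by
  obtain ⟨c, rfl⟩ := mem_boundedL2_iff.1 hu
  have h : MemLp (fun x => b x * c x) ∞ μ := (Lp.memLp c).mul (Lp.memLp b)
  refine (memLp_congr_ae ?_).2 h
  filter_upwards [coeFn_mulL b (ofLinfty μ c), coeFn_ofLinfty c] with x h1 h2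
  rw [h1, h2]

theorem denseRange_ofLinfty : DenseRange (ofLinfty μ) := by
  intro f
  refine Lp.induction (by simp) (motive := fun f => f ∈ closure (Set.range (ofLinfty μ))) ?_ ?_
    isClosed_closure f
  · intro c s hs hμs
    refine subset_closure ⟨indicatorConstLp ∞ hs hμs.ne c, ?_⟩
    apply Lp.ext
    refine (coeFn_ofLinfty _).trans ?_
    rw [Lp.simpleFunc.coe_indicatorConst]
    exact indicatorConstLp_coeFn.trans indicatorConstLp_coeFn.symm
  · intro f g hf hg _ h1 h2
    exact (LinearMap.range (ofLinfty μ).toLinearMap).topologicalClosure.add_mem h1 h2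

theorem ofLinfty_mem_boundedBy {b : Lp ℂ ∞ μ} {C : ℝ} (hb : ‖b‖ ≤ C) :
    ofLinfty μ b ∈ boundedBy μ C := by
  filter_upwards [coeFn_ofLinfty b, ae_norm_le_norm_linfty b] with x h1 h2
  rw [h1]
  exact h2.trans hb

theorem norm_le_of_ofLinfty_mem_boundedBy {b : Lp ℂ ∞ μ} {C : ℝ} (hC : 0 ≤ C)
    (h : ofLinfty μ b ∈ boundedBy μ C) : ‖b‖ ≤ C := by
  rw [Lp.norm_def, eLpNorm_exponent_top]
  refine ENNReal.toReal_le_of_le_ofReal hC (eLpNormEssSup_le_of_ae_bound ?_)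
  filter_upwards [coeFn_ofLinfty b, h] with x h1 h2
  rwa [← h1]

/-- Multiplication is jointly continuous in `L₂` as long as the bounded factor stays bounded. -/
theorem tendsto_mulL {ι : Type*} {l : Filter ι} {F : ι → Lp ℂ ∞ μ} {F₀ : Lp ℂ ∞ μ}
    {u : ι → Lp ℂ 2 μ} {u₀ : Lp ℂ 2 μ} {C : ℝ} (hC : ∀ᶠ i in l, ‖F i‖ ≤ C)
    (hF : Tendsto (fun i => ofLinfty μ (F i)) l (𝓝 (ofLinfty μ F₀))) (hu : Tendsto u l (𝓝 u₀)) :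
    Tendsto (fun i => mulL μ (F i) (u i)) l (𝓝 (mulL μ F₀ u₀)) := by
  rcases l.eq_or_neBot with rfl | hl
  · exact tendsto_bot
  have hC0 : 0 ≤ C := by
    obtain ⟨i, hi⟩ := hC.exists
    exact (norm_nonneg _).trans hi
  have key : Tendsto (fun i => mulL μ (F i) u₀) l (𝓝 (mulL μ F₀ u₀)) := by
    rw [Metric.tendsto_nhds]
    intro ε hε
    have hpos : 0 < C + ‖F₀‖ + 1 := by positivity
    -- Replace `u₀` by a bounded `b`: the uniform bound on `F i - F₀` controls the error, and on `b`
    -- the roles of the factors swap, so that `hF` applies. The `+ 1` in `hpos` keeps the divisor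
    -- positive.
    obtain ⟨b, hb⟩ := denseRange_ofLinfty.exists_dist_lt u₀ (ε := ε / 2 / (C + ‖F₀‖ + 1))
      (by positivity)
    have h1 : Tendsto (fun i => mulL μ b (ofLinfty μ (F i))) l (𝓝 (mulL μ b (ofLinfty μ F₀))) :=
      ((mulL μ b).continuous.tendsto _).comp hF
    filter_upwards [hC, Metric.tendsto_nhds.1 h1 (ε / 2) (by positivity)] with i hi h2
    rw [mulL_ofLinfty_comm, mulL_ofLinfty_comm b, dist_eq_norm] at h2
    rw [dist_eq_norm] at hb ⊢
    have e : mulL μ (F i) u₀ - mulL μ F₀ u₀ = mulL μ (F i - F₀) (u₀ - ofLinfty μ b) +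
        (mulL μ (F i) (ofLinfty μ b) - mulL μ F₀ (ofLinfty μ b)) := by
      simp only [map_sub, sub_apply]; abel
    have h3 : ‖mulL μ (F i - F₀) (u₀ - ofLinfty μ b)‖ ≤ ε / 2 := by
      refine (norm_mulL_le _ _).trans ?_
      have h4 : ‖F i - F₀‖ ≤ C + ‖F₀‖ + 1 := by
        have := norm_sub_le (F i) F₀
        linarith
      calc _ ≤ (C + ‖F₀‖ + 1) * (ε / 2 / (C + ‖F₀‖ + 1)) := by gcongr
        _ = ε / 2 := by field_simp
    rw [e]
    exact (norm_add_le _ _).trans_lt (by linarith)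
  have h0 : Tendsto (fun i => mulL μ (F i) (u i - u₀)) l (𝓝 0) := by
    have h1 : Tendsto (fun i => C * ‖u i - u₀‖) l (𝓝 0) := by
      simpa using (tendsto_iff_norm_sub_tendsto_zero.1 hu).const_mul C
    refine squeeze_zero_norm' ?_ h1
    filter_upwards [hC] with i hi
    exact (norm_mulL_le _ _).trans (by gcongr)
  simpa using h0.add key

end BoundedMultiplication

/-! ### Elementary facts on `C₀`-groups -/

section C0GroupLemmas

variable {H : Type*} [NormedAddCommGroup H] [NormedSpace ℂ H] {U : ℝ → H →L[ℂ] H}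

theorem IsC0Group.zero_apply (hU : IsC0Group U) (f : H) : U 0 f = f := by
  rw [hU.map_zero, ContinuousLinearMap.id_apply]

theorem IsC0Group.add_apply (hU : IsC0Group U) (s t : ℝ) (f : H) : U (s + t) f = U s (U t f) := by
  rw [hU.map_add, ContinuousLinearMap.comp_apply]

theorem IsC0Group.apply_neg_apply (hU : IsC0Group U) (t : ℝ) (f : H) : U t (U (-t) f) = f := by
  rw [← hU.add_apply, add_neg_cancel, hU.zero_apply]

theorem IsC0Group.hasGeneratorAt_apply (hU : IsC0Group U) {f g : H} (h : HasGeneratorAt U f g)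
    (s : ℝ) : HasGeneratorAt U (U s f) (U s g) := by
  refine (((U s).continuous.tendsto g).comp h).congr fun t => ?_
  simp only [Function.comp_apply, map_smul, map_sub]
  rw [← hU.add_apply, ← hU.add_apply, add_comm]

variable [NormedSpace ℝ H]

theorem IsC0Group.tendsto_average [CompleteSpace H] (hU : IsC0Group U) (f : H) :
    Tendsto (fun r : ℝ => r⁻¹ • ∫ s in (0 : ℝ)..r, U s f) (𝓝[≠] 0) (𝓝 f) := by
  have hc := hU.continuous_orbit f
  have h2 : HasDerivAt (fun t : ℝ => ∫ s in (0 : ℝ)..t, U s f) (U 0 f) 0 :=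
    intervalIntegral.integral_hasDerivAt_right (hc.intervalIntegrable _ _)
      (hc.stronglyMeasurableAtFilter _ _) hc.continuousAt
  rw [hasDerivAt_iff_tendsto_slope_zero] at h2
  simpa [hU.zero_apply] using h2

variable [IsScalarTower ℝ ℂ H]

theorem IsC0Group.hasGeneratorAt_iff (hU : IsC0Group U) {f g : H} :
    HasGeneratorAt U f g ↔ HasDerivAt (fun t : ℝ => U t f) g 0 := by
  rw [hasDerivAt_iff_tendsto_slope_zero, HasGeneratorAt]
  refine tendsto_congr fun t => ?_
  rw [zero_add, hU.zero_apply, ← Complex.ofReal_inv, ← Complex.coe_algebraMap, algebraMap_smul]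

/-- Applying `U t` shifts the interval of integration to `[t, t + r]`; differentiating at both
endpoints gives the value. -/
theorem IsC0Group.hasGeneratorAt_integral [CompleteSpace H] (hU : IsC0Group U) (f : H) (r : ℝ) :
    HasGeneratorAt U (∫ s in (0 : ℝ)..r, U s f) (U r f - f) := by
  rw [hU.hasGeneratorAt_iff]
  have hc := hU.continuous_orbit f
  have hi : ∀ a b : ℝ, IntervalIntegrable (fun s => U s f) volume a b := fun a b =>
    hc.intervalIntegrable a b
  have h1 : ∀ t : ℝ, U t (∫ s in (0 : ℝ)..r, U s f) =
      (∫ s in (0 : ℝ)..(t + r), U s f) - ∫ s in (0 : ℝ)..t, U s f := by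
    intro t
    rw [← ContinuousLinearMap.intervalIntegral_comp_comm _ (hi 0 r)]
    simp_rw [← hU.add_apply]
    rw [intervalIntegral.integral_comp_add_left (fun s => U s f) t, add_zero,
      intervalIntegral.integral_interval_sub_left (hi _ _) (hi _ _)]
  simp_rw [h1]
  have h2 : HasDerivAt (fun t : ℝ => ∫ s in (0 : ℝ)..t, U s f) (U 0 f) 0 :=
    intervalIntegral.integral_hasDerivAt_right (hi _ _)
      (hc.stronglyMeasurableAtFilter _ _) hc.continuousAt
  have h3 : HasDerivAt (fun t : ℝ => ∫ s in (0 : ℝ)..t, U s f) (U (0 + r) f) (0 + r) :=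
    intervalIntegral.integral_hasDerivAt_right (hi _ _)
      (hc.stronglyMeasurableAtFilter _ _) hc.continuousAt
  have h4 := (h3.comp_add_const 0 r).sub h2
  rw [hU.zero_apply, zero_add] at h4
  exact h4

end C0GroupLemmas

theorem IsUnitaryC0Group.norm_apply {H : Type*} [NormedAddCommGroup H] [InnerProductSpace ℂ H]
    [CompleteSpace H] {U : ℝ → H →L[ℂ] H} (hU : IsUnitaryC0Group U) (t : ℝ) (f : H) :
    ‖U t f‖ = ‖f‖ :=
  (ContinuousLinearMap.norm_map_iff_adjoint_comp_self _).2 (Unitary.mem_iff.1 (hU.unitary_mem t)).1 f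

/-- A family of isometries that is a one-parameter group, strongly continuous at `0`, is a unitary
`C₀`-group. -/
theorem isUnitaryC0Group_of_isometry {H : Type*} [NormedAddCommGroup H] [InnerProductSpace ℂ H]
    [CompleteSpace H] {V : ℝ → H →L[ℂ] H} (h0 : V 0 = ContinuousLinearMap.id ℂ H)
    (hadd : ∀ s t, V (s + t) = (V s).comp (V t)) (hn : ∀ t f, ‖V t f‖ = ‖f‖)
    (hc : ∀ f, Tendsto (fun t => V t f) (𝓝 0) (𝓝 f)) : IsUnitaryC0Group V := by
  have hs : ∀ t, star (V t) * V t = 1 := fun t =>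
    (ContinuousLinearMap.norm_map_iff_adjoint_comp_self _).1 (hn t)
  have hr : ∀ t, V t * V (-t) = 1 := fun t => by
    have := hadd t (-t)
    rw [add_neg_cancel, h0] at this
    exact this.symm
  refine ⟨⟨h0, hadd, fun f => ?_⟩, fun t => ?_⟩
  · rw [continuous_iff_continuousAt]
    intro t
    have h1 : Tendsto (fun s => s - t) (𝓝 t) (𝓝 0) := by
      rw [← sub_self t]
      exact tendsto_id.sub_const t
    refine (((V t).continuous.tendsto f).comp ((hc f).comp h1)).congr fun s => ?_
    have := hadd t (s - t)
    rw [add_sub_cancel] at this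
    rw [this]
    rfl
  · rw [Unitary.mem_iff]
    refine ⟨hs t, ?_⟩
    have h1 : star (V t) = V (-t) := by
      rw [← mul_one (star (V t)), ← hr t, ← mul_assoc, hs, one_mul]
    rw [h1, hr]

/-! ### The product rule -/

section ProductRule

variable {X : Type*} [MeasurableSpace X] {μ : Measure X} [IsFiniteMeasure μ]

/-- The product rule for bounded elements of the domain of the generator, under the assumption that
the orbit of one of the factors is bounded in `L_∞`. -/
theorem IsC0Group.tendsto_slope_mulL {V : ℝ → Lp ℂ 2 μ →L[ℂ] Lp ℂ 2 μ} (hV : IsC0Group V)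
    {F G : Lp ℂ ∞ μ} {f' g' : Lp ℂ 2 μ} (hF : HasGeneratorAt V (ofLinfty μ F) f')
    (hG : HasGeneratorAt V (ofLinfty μ G) g') {W : ℝ → Lp ℂ ∞ μ} {C : ℝ}
    (hW : ∀ t, ofLinfty μ (W t) = V t (ofLinfty μ F)) (hC : ∀ᶠ t in 𝓝 (0 : ℝ), ‖W t‖ ≤ C) :
    Tendsto (fun t : ℝ => (t : ℂ)⁻¹ • (mulL μ (W t) (V t (ofLinfty μ G)) - mulL μ F (ofLinfty μ G)))
      (𝓝[≠] 0) (𝓝 (mulL μ G f' + mulL μ F g')) := by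
  have h1 : Tendsto (fun t => ofLinfty μ (W t)) (𝓝[≠] 0) (𝓝 (ofLinfty μ F)) := by
    simp_rw [hW]
    have := (hV.continuous_orbit (ofLinfty μ F)).tendsto 0
    rw [hV.zero_apply] at this
    exact this.mono_left nhdsWithin_le_nhds
  have h2 := tendsto_mulL (hC.filter_mono nhdsWithin_le_nhds) h1 hG
  -- The splitting is `V_t F · V_t G - F G = G (V_t F - F) + V_t F (V_t G - G)`. The fixed factor
  -- `G` is harmless; the moving factor `V_t F` needs the `L_∞`-bound.
  have h3 := ((mulL μ G).continuous.tendsto f').comp hF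
  refine (h3.add h2).congr fun t => ?_
  simp only [Function.comp_apply, map_smul, map_sub, ← hW]
  rw [mulL_ofLinfty_comm G (W t), mulL_ofLinfty_comm G F, ← smul_add]
  congr 1
  abel

end ProductRule

/-! ### Groups that preserve `L_∞` -/

section PreservesLInfty

variable {X : Type*} [MeasurableSpace X] {μ : Measure X} [IsFiniteMeasure μ]

/-- A bounded operator on `L₂` that leaves `L_∞` invariant is bounded on `L_∞`, by the closed graph
theorem. -/
theorem exists_linfty_restriction (T : Lp ℂ 2 μ →L[ℂ] Lp ℂ 2 μ)
    (hT : ∀ f ∈ boundedL2 μ, T f ∈ boundedL2 μ) :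
    ∃ S : Lp ℂ ∞ μ →L[ℂ] Lp ℂ ∞ μ, ∀ b, ofLinfty μ (S b) = T (ofLinfty μ b) := by
  choose S hS using fun b => mem_boundedL2_iff.1 (hT _ (ofLinfty_mem_boundedL2 b))
  let S' : Lp ℂ ∞ μ →ₗ[ℂ] Lp ℂ ∞ μ :=
    { toFun := S
      map_add' := fun b c => ofLinfty_injective <| by simp only [map_add, hS]
      map_smul' := fun r b => ofLinfty_injective <| by simp only [map_smul, hS, RingHom.id_apply] }
  have hc : Continuous S' := by
    refine S'.continuous_of_seq_closed_graph fun u x y hu hy => ?_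
    refine ofLinfty_injective ?_
    have h1 := ((ofLinfty μ).continuous.tendsto y).comp hy
    have h2 := (T.continuous.tendsto _).comp (((ofLinfty μ).continuous.tendsto x).comp hu)
    rw [← hS] at h2
    refine tendsto_nhds_unique h1 (h2.congr fun n => ?_)
    exact (hS _).symm
  exact ⟨⟨S', hc⟩, hS⟩

variable {V : ℝ → Lp ℂ 2 μ →L[ℂ] Lp ℂ 2 μ}

/-- The orbits of bounded functions are bounded in `L_∞` for small times, by Baire's theorem. -/
theorem PreservesLInfty.eventually_norm_le (hinf : PreservesLInfty V) (hV : IsC0Group V)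
    (b : Lp ℂ ∞ μ) :
    ∃ C, ∀ᶠ t in 𝓝 (0 : ℝ), ∀ c, ofLinfty μ c = V t (ofLinfty μ b) → ‖c‖ ≤ C := by
  have hcl : ∀ n : ℕ, IsClosed {s : ℝ | V s (ofLinfty μ b) ∈ boundedBy μ n} := fun n =>
    (isClosed_boundedBy _).preimage (hV.continuous_orbit _)
  have hun : ⋃ n : ℕ, {s : ℝ | V s (ofLinfty μ b) ∈ boundedBy μ n} = Set.univ := by
    refine Set.eq_univ_of_forall fun s => ?_
    obtain ⟨c, hc⟩ := mem_boundedL2_iff.1 (hinf s _ (ofLinfty_mem_boundedL2 b))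
    obtain ⟨n, hn⟩ := exists_nat_ge ‖c‖
    refine Set.mem_iUnion.2 ⟨n, ?_⟩
    change V s (ofLinfty μ b) ∈ boundedBy μ n
    rw [← hc]
    exact ofLinfty_mem_boundedBy hn
  -- Baire bounds the orbit only near some `s`; applying `V (-s)`, which is bounded on `L_∞`,
  -- transports the bound to a neighbourhood of `0`.
  obtain ⟨n, s, hs⟩ := nonempty_interior_of_iUnion_of_closed hcl hun
  obtain ⟨S, hS⟩ := exists_linfty_restriction _ (hinf (-s))
  refine ⟨‖S‖ * n, ?_⟩
  have h1 : Tendsto (fun t : ℝ => s + t) (𝓝 0) (𝓝 s) := by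
    simpa using (tendsto_id (x := 𝓝 (0 : ℝ))).const_add s
  filter_upwards [h1 (mem_interior_iff_mem_nhds.1 hs)] with t ht c hc
  have ht' : V (s + t) (ofLinfty μ b) ∈ boundedBy μ n := ht
  obtain ⟨d, hd⟩ := mem_boundedL2_iff.1 (boundedBy_subset_boundedL2 ht')
  rw [← hd] at ht'
  have hcd : c = S d := ofLinfty_injective <| by
    rw [hS, hd, ← hV.add_apply, hc, neg_add_cancel_left]
  rw [hcd]
  exact (S.le_opNorm d).trans
    (by gcongr; exact norm_le_of_ofLinfty_mem_boundedBy n.cast_nonneg ht')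

/-- Averages of the orbit of a bounded function over `(0, r]` lie in the domain and converge to the
function as `r → 0`. For small `r` they are bounded, because `boundedBy μ C` is closed and convex
and contains the orbit for small times. -/
theorem PreservesLInfty.dense_domain (hinf : PreservesLInfty V) (hV : IsC0Group V) :
    Dense (((groupGenerator V).domain ⊓ boundedL2 μ : Submodule ℂ (Lp ℂ 2 μ)) : Set (Lp ℂ 2 μ)) := by
  have h : Set.range (ofLinfty μ) ⊆
      closure ((groupGenerator V).domain ⊓ boundedL2 μ : Submodule ℂ (Lp ℂ 2 μ)) := by
    rintro _ ⟨b, rfl⟩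
    obtain ⟨C, hC⟩ := hinf.eventually_norm_le hV b
    refine mem_closure_of_tendsto ((hV.tendsto_average (ofLinfty μ b)).mono_left
      (nhdsGT_le_nhdsNE 0)) ?_
    obtain ⟨δ, hδ, hball⟩ := Metric.eventually_nhds_iff.1 hC
    filter_upwards [Ioo_mem_nhdsGT hδ] with r hr
    refine ⟨?_, ?_⟩
    · have := Submodule.smul_mem (groupGenerator V).domain ((r⁻¹ : ℝ) : ℂ)
        (mem_groupGenerator_domain.2 ⟨_, hV.hasGeneratorAt_integral (ofLinfty μ b) r⟩)
      rwa [← Complex.coe_algebraMap, algebraMap_smul] at this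
    · refine boundedBy_subset_boundedL2 (C := C) ?_
      have e : r⁻¹ • ∫ s in (0 : ℝ)..r, V s (ofLinfty μ b) =
          ⨍ s in Set.Ioc 0 r, V s (ofLinfty μ b) := by
        rw [intervalIntegral.integral_of_le hr.1.le, setAverage_eq]
        simp [measureReal_def, hr.1.le]
      rw [e]
      refine (convex_boundedBy C).set_average_mem (isClosed_boundedBy C) (by simp [hr.1])
        (by simp) ?_ ((hV.continuous_orbit _).integrableOn_Ioc)
      filter_upwards [ae_restrict_mem measurableSet_Ioc] with s hs
      obtain ⟨c, hc⟩ := mem_boundedL2_iff.1 (hinf s _ (ofLinfty_mem_boundedL2 b))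
      rw [← hc]
      refine ofLinfty_mem_boundedBy (hball ?_ c hc)
      rw [Real.dist_0_eq_abs, abs_of_pos hs.1]
      exact hs.2.trans_lt hr.2
  exact (denseRange_ofLinfty.mono h).of_closure

/-- If the generator is a derivation on the algebra of its bounded elements, then the group is
multiplicative. -/
theorem PreservesLInfty.map_mulL_of_isDerivationOn (hinf : PreservesLInfty V)
    (hV : IsUnitaryC0Group V)
    (halg : IsFunctionAlgebra ((groupGenerator V).domain ⊓ boundedL2 μ))
    (hder : IsDerivationOn (groupGenerator V) ((groupGenerator V).domain ⊓ boundedL2 μ))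
    (t : ℝ) (F F' : Lp ℂ ∞ μ) (hF : ofLinfty μ F' = V t (ofLinfty μ F)) (u : Lp ℂ 2 μ) :
    V t (mulL μ F u) = mulL μ F' (V t u) := by
  have hV' := hV.toIsC0Group
  choose W hWn using fun s => exists_linfty_restriction _ (hinf s)
  have hprod : ∀ (F G : Lp ℂ ∞ μ) (f' g' : Lp ℂ 2 μ), HasGeneratorAt V (ofLinfty μ F) f' →
      HasGeneratorAt V (ofLinfty μ G) g' →
      HasGeneratorAt V (mulL μ F (ofLinfty μ G)) (mulL μ G f' + mulL μ F g') := by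
    intro F G f' g' hf hg
    have hFd : ofLinfty μ F ∈ (groupGenerator V).domain := ⟨f', hf⟩
    have hGd : ofLinfty μ G ∈ (groupGenerator V).domain := ⟨g', hg⟩
    obtain ⟨h, hh', hmul⟩ := halg _ ⟨hFd, ofLinfty_mem_boundedL2 F⟩ _
      ⟨hGd, ofLinfty_mem_boundedL2 G⟩
    have hh := (Submodule.mem_inf.1 hh').1
    have hm := hder.2 ⟨_, hFd⟩ ⟨_, hGd⟩ ⟨h, hh⟩ ⟨hFd, ofLinfty_mem_boundedL2 F⟩
      ⟨hGd, ofLinfty_mem_boundedL2 G⟩ hh' hmul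
    have e1 : h = mulL μ F (ofLinfty μ G) := by
      apply Lp.ext
      filter_upwards [hmul, coeFn_mulL F (ofLinfty μ G), coeFn_ofLinfty F] with x h1 h2 h3
      rw [h1, h2, h3]
    have e2 : groupGenerator V ⟨h, hh⟩ = mulL μ G f' + mulL μ F g' := by
      rw [(hasGeneratorAt_groupGenerator ⟨_, hFd⟩).unique hf,
        (hasGeneratorAt_groupGenerator ⟨_, hGd⟩).unique hg] at hm
      apply Lp.ext
      filter_upwards [hm, Lp.coeFn_add (mulL μ G f') (mulL μ F g'), coeFn_mulL F g',
        coeFn_mulL G f', coeFn_ofLinfty F, coeFn_ofLinfty G] with x h1 h2 h3 h4 h5 h6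
      rw [h1, h2, Pi.add_apply, h3, h4, h5, h6, mul_comm (f' x)]
    have h3 : HasGeneratorAt V h (groupGenerator V ⟨h, hh⟩) :=
      hasGeneratorAt_groupGenerator ⟨h, hh⟩
    rw [e2] at h3
    rwa [← e1]
  -- The product of the orbits and the orbit of the product have the same derivative at `0`, so they
  -- agree to first order.
  have hzero : ∀ (F G : Lp ℂ ∞ μ) (f' g' : Lp ℂ 2 μ), HasGeneratorAt V (ofLinfty μ F) f' →
      HasGeneratorAt V (ofLinfty μ G) g' →
      Tendsto (fun h : ℝ => (h : ℂ)⁻¹ • (mulL μ (W h F) (V h (ofLinfty μ G)) -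
        V h (mulL μ F (ofLinfty μ G)))) (𝓝[≠] 0) (𝓝 0) := by
    intro F G f' g' hf hg
    obtain ⟨C, hC⟩ := hinf.eventually_norm_le hV' F
    have h1 := hV'.tendsto_slope_mulL hf hg (W := fun s => W s F) (fun s => hWn s F)
      (hC.mono fun s hs => hs _ (hWn s F))
    have h2 : Tendsto _ _ _ := hprod F G f' g' hf hg
    have h3 := h1.sub h2
    rw [sub_self] at h3
    refine h3.congr fun h => ?_
    rw [← smul_sub]
    congr 1
    abel
  have hmulD : ∀ F G : Lp ℂ ∞ μ, ofLinfty μ F ∈ (groupGenerator V).domain →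
      ofLinfty μ G ∈ (groupGenerator V).domain →
      V t (mulL μ F (ofLinfty μ G)) = mulL μ (W t F) (V t (ofLinfty μ G)) := by
    rintro F G ⟨f', hf⟩ ⟨g', hg⟩
    -- `Q` is constant exactly when `V` is multiplicative on this pair.
    let Q : ℝ → Lp ℂ 2 μ := fun s => V (-s) (mulL μ (W s F) (V s (ofLinfty μ G)))
    have hQ : ∀ s, HasDerivAt Q 0 s := by
      intro s
      rw [hasDerivAt_iff_tendsto_slope_zero, tendsto_zero_iff_norm_tendsto_zero]
      have hf2 := hV'.hasGeneratorAt_apply hf s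
      have hg2 := hV'.hasGeneratorAt_apply hg s
      rw [← hWn] at hf2 hg2
      -- The increment `Q (s + h) - Q s` is `V (-(s + h))` applied to the difference in `hzero` for
      -- the pair `V_s F`, `V_s G`; the isometry drops out of the norm.
      refine (tendsto_zero_iff_norm_tendsto_zero.1 (hzero _ _ _ _ hf2 hg2)).congr fun h => ?_
      have e1 : W h (W s F) = W (s + h) F := ofLinfty_injective <| by
        rw [hWn, hWn, hWn, ← hV'.add_apply, add_comm]
      have e2 : V h (ofLinfty μ (W s G)) = V (s + h) (ofLinfty μ G) := by
        rw [hWn, ← hV'.add_apply, add_comm]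
      rw [e1, e2, norm_smul, norm_smul, norm_inv, norm_inv, Complex.norm_real,
        ← hV.norm_apply (-(s + h)), map_sub, ← hV'.add_apply, hWn,
        show -(s + h) + h = -s by ring]
    have hc : Q t = Q 0 := is_const_of_deriv_eq_zero (fun s => (hQ s).differentiableAt)
      (fun s => (hQ s).deriv) t 0
    have h0 : W 0 F = F := ofLinfty_injective <| by rw [hWn, hV'.zero_apply]
    have h1 := congrArg (V t) hc
    simp only [Q, neg_zero, hV'.zero_apply, hV'.apply_neg_apply, h0] at h1
    exact h1.symm
  have hW : F' = W t F := ofLinfty_injective (hF.trans (hWn t F).symm)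
  have hdense := hinf.dense_domain hV'
  -- Density extends the second factor to all of `L₂` first. Since that covers every bounded
  -- function, swapping the factors then removes the domain condition from `F`, and density is used
  -- once more for `u`.
  have hmulD' : ∀ F : Lp ℂ ∞ μ, ofLinfty μ F ∈ (groupGenerator V).domain → ∀ u : Lp ℂ 2 μ,
      V t (mulL μ F u) = mulL μ (W t F) (V t u) := by
    intro F hFd u
    refine congrFun (Continuous.ext_on (f := fun u => V t (mulL μ F u))
      (g := fun u => mulL μ (W t F) (V t u)) hdense (by fun_prop) (by fun_prop) ?_) u
    rintro _ ⟨hG, hGb⟩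
    obtain ⟨G, rfl⟩ := mem_boundedL2_iff.1 hGb
    exact hmulD F G hFd hG
  rw [hW]
  refine congrFun (Continuous.ext_on (f := fun u => V t (mulL μ F u))
    (g := fun u => mulL μ (W t F) (V t u)) hdense (by fun_prop) (by fun_prop) ?_) u
  rintro _ ⟨hG, hGb⟩
  obtain ⟨G, rfl⟩ := mem_boundedL2_iff.1 hGb
  change V t (mulL μ F (ofLinfty μ G)) = mulL μ (W t F) (V t (ofLinfty μ G))
  rw [mulL_ofLinfty_comm, hmulD' G hG, ← hWn, ← hWn, mulL_ofLinfty_comm]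

end PreservesLInfty

/-! ### Point realization of multiplicative isometries -/

section PointRealization

variable {X : Type*} [MeasurableSpace X] {μ : Measure X} [IsFiniteMeasure μ]

/-- The operator `T` maps the indicator function of `A` to the one of `B`. -/
def MapsIndicator (T : Lp ℂ 2 μ →L[ℂ] Lp ℂ 2 μ) (A B : Set X) : Prop :=
  ∃ (hA : MeasurableSet A) (hB : MeasurableSet B),
    T (indicatorConstLp 2 hA (measure_ne_top μ A) (1 : ℂ)) =
      indicatorConstLp 2 hB (measure_ne_top μ B) (1 : ℂ)

/-- The operator `T` is multiplicative on `L_∞`. -/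
def IsMultiplicativeL2 (T : Lp ℂ 2 μ →L[ℂ] Lp ℂ 2 μ) : Prop :=
  ∀ F F' : Lp ℂ ∞ μ, ofLinfty μ F' = T (ofLinfty μ F) → ∀ u : Lp ℂ 2 μ,
    T (mulL μ F u) = mulL μ F' (T u)

theorem ofLinfty_indicatorConstLp {A : Set X} (hA : MeasurableSet A) (c : ℂ) :
    ofLinfty μ (indicatorConstLp ∞ hA (measure_ne_top μ A) c) =
      indicatorConstLp 2 hA (measure_ne_top μ A) c := by
  apply Lp.ext
  exact (coeFn_ofLinfty _).trans (indicatorConstLp_coeFn.trans indicatorConstLp_coeFn.symm)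

theorem indicatorConstLp_eq_smul {A : Set X} (hA : MeasurableSet A) (c : ℂ) :
    indicatorConstLp 2 hA (measure_ne_top μ A) c =
      c • indicatorConstLp 2 hA (measure_ne_top μ A) (1 : ℂ) := by
  apply Lp.ext
  filter_upwards [Lp.coeFn_smul c (indicatorConstLp 2 hA (measure_ne_top μ A) (1 : ℂ)),
    indicatorConstLp_coeFn (p := 2) (hs := hA) (hμs := measure_ne_top μ A) (c := (1 : ℂ)),
    indicatorConstLp_coeFn (p := 2) (hs := hA) (hμs := measure_ne_top μ A) (c := c)]
    with x h1 h2 h3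
  rw [h1, Pi.smul_apply, h2, h3]
  by_cases hx : x ∈ A <;> simp [hx]

theorem mulL_indicatorConstLp {A B : Set X} (hA : MeasurableSet A) (hB : MeasurableSet B) :
    mulL μ (indicatorConstLp ∞ hA (measure_ne_top μ A) 1)
      (indicatorConstLp 2 hB (measure_ne_top μ B) 1) =
      indicatorConstLp 2 (hA.inter hB) (measure_ne_top μ _) 1 := by
  apply Lp.ext
  filter_upwards [coeFn_mulL (indicatorConstLp ∞ hA (measure_ne_top μ A) 1)
    (indicatorConstLp 2 hB (measure_ne_top μ B) 1),
    indicatorConstLp_coeFn (p := ∞) (hs := hA) (hμs := measure_ne_top μ A) (c := (1 : ℂ)),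
    indicatorConstLp_coeFn (p := 2) (hs := hB) (hμs := measure_ne_top μ B) (c := (1 : ℂ)),
    indicatorConstLp_coeFn (p := 2) (hs := hA.inter hB) (hμs := measure_ne_top μ _) (c := (1 : ℂ))]
    with x h1 h2 h3 h4
  rw [h1, h2, h3, h4]
  by_cases ha : x ∈ A <;> by_cases hb : x ∈ B <;> simp [ha, hb]

theorem indicatorConstLp_compl_eq {A : Set X} (hA : MeasurableSet A) :
    indicatorConstLp 2 hA.compl (measure_ne_top μ _) (1 : ℂ) =
      Lp.const 2 μ 1 - indicatorConstLp 2 hA (measure_ne_top μ A) 1 := by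
  rw [← indicatorConstLp_univ, eq_sub_iff_add_eq, ← indicatorConstLp_disjoint_union]
  · simp
  · exact disjoint_compl_left

variable {T : Lp ℂ 2 μ →L[ℂ] Lp ℂ 2 μ}

theorem MapsIndicator.compl (h1 : T (Lp.const 2 μ 1) = Lp.const 2 μ 1) {A B : Set X}
    (h : MapsIndicator T A B) : MapsIndicator T Aᶜ Bᶜ := by
  obtain ⟨hA, hB, h⟩ := h
  refine ⟨hA.compl, hB.compl, ?_⟩
  rw [indicatorConstLp_compl_eq hA, map_sub, h1, h, indicatorConstLp_compl_eq hB]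

theorem MapsIndicator.inter (hT : IsMultiplicativeL2 T) {A B A' B' : Set X}
    (h : MapsIndicator T A B) (h' : MapsIndicator T A' B') :
    MapsIndicator T (A ∩ A') (B ∩ B') := by
  obtain ⟨hA, hB, h⟩ := h
  obtain ⟨hA', hB', h'⟩ := h'
  refine ⟨hA.inter hA', hB.inter hB', ?_⟩
  rw [← mulL_indicatorConstLp hA hA', ← mulL_indicatorConstLp hB hB', ← h']
  apply hT
  rw [ofLinfty_indicatorConstLp, ofLinfty_indicatorConstLp, h]

theorem MapsIndicator.union (h1 : T (Lp.const 2 μ 1) = Lp.const 2 μ 1) (hT : IsMultiplicativeL2 T)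
    {A B A' B' : Set X} (h : MapsIndicator T A B) (h' : MapsIndicator T A' B') :
    MapsIndicator T (A ∪ A') (B ∪ B') := by
  simpa [Set.compl_inter] using ((h.compl h1).inter hT (h'.compl h1)).compl h1

theorem tendsto_indicatorConstLp_accumulate {A : ℕ → Set X} (hA : ∀ n, MeasurableSet (A n))
    (hA' : ∀ n, MeasurableSet (Set.accumulate A n)) :
    Tendsto (fun n => indicatorConstLp 2 (hA' n) (measure_ne_top μ _) (1 : ℂ)) atTop
      (𝓝 (indicatorConstLp 2 (MeasurableSet.iUnion hA) (measure_ne_top μ _) 1)) := by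
  refine tendsto_indicatorConstLp_set (by simp) ?_
  have h1 := tendsto_measure_iUnion_accumulate (μ := μ) (f := A)
  have h2 := ENNReal.Tendsto.sub (tendsto_const_nhds (x := μ (⋃ n, A n)) (f := atTop)) h1
    (Or.inl (measure_ne_top μ _))
  rw [tsub_self] at h2
  refine h2.congr fun n => ?_
  have hsub : Set.accumulate A n ⊆ ⋃ n, A n := Set.accumulate_subset_iUnion n
  rw [← measure_sdiff hsub (hA' n).nullMeasurableSet (measure_ne_top μ _),
    symmDiff_of_le hsub]

/-- Finite unions follow from complements and intersections; continuity of `T` passes to the limit,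
since the indicators of the partial unions converge in `L₂`. -/
theorem MapsIndicator.iUnion (h1 : T (Lp.const 2 μ 1) = Lp.const 2 μ 1)
    (hT : IsMultiplicativeL2 T) {A B : ℕ → Set X} (h : ∀ n, MapsIndicator T (A n) (B n)) :
    MapsIndicator T (⋃ n, A n) (⋃ n, B n) := by
  have hacc : ∀ n, MapsIndicator T (Set.accumulate A n) (Set.accumulate B n) := by
    intro n
    induction n with
    | zero => simpa using h 0
    | succ n ih =>
      rw [Set.accumulate_succ, Set.accumulate_succ]
      exact ih.union h1 hT (h _)
  choose hA hB hAB using h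
  choose hA' hB' hAB' using hacc
  refine ⟨MeasurableSet.iUnion hA, MeasurableSet.iUnion hB, ?_⟩
  refine tendsto_nhds_unique
    ((T.continuous.tendsto _).comp (tendsto_indicatorConstLp_accumulate hA hA')) ?_
  refine (tendsto_indicatorConstLp_accumulate hB hB').congr fun n => ?_
  exact (hAB' n).symm

/-- The image `c` of an indicator satisfies `c² = c`, so it takes only the values `0` and `1` a.e.
-/
theorem exists_mapsIndicator (hT : IsMultiplicativeL2 T)
    (hinf : ∀ f ∈ boundedL2 μ, T f ∈ boundedL2 μ) {A : Set X} (hA : MeasurableSet A) :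
    ∃ B, MapsIndicator T A B := by
  set F : Lp ℂ ∞ μ := indicatorConstLp ∞ hA (measure_ne_top μ A) 1 with hFdef
  obtain ⟨c, hc⟩ := mem_boundedL2_iff.1 (hinf _ (ofLinfty_mem_boundedL2 F))
  have h1 := hT F c hc (ofLinfty μ F)
  have h2 : mulL μ F (ofLinfty μ F) = ofLinfty μ F := by
    rw [hFdef, ofLinfty_indicatorConstLp, mulL_indicatorConstLp]
    simp only [Set.inter_self]
  rw [h2, ← hc] at h1
  have hB : MeasurableSet (c ⁻¹' {1}) :=
    (Lp.stronglyMeasurable c).measurable (measurableSet_singleton 1)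
  refine ⟨c ⁻¹' {1}, hA, hB, ?_⟩
  rw [← ofLinfty_indicatorConstLp, ← hFdef, ← hc]
  apply Lp.ext
  have h3 := coeFn_mulL c (ofLinfty μ c)
  rw [← h1] at h3
  filter_upwards [h3, coeFn_ofLinfty c,
    indicatorConstLp_coeFn (p := 2) (hs := hB) (hμs := measure_ne_top μ _) (c := (1 : ℂ))]
    with x hx1 hx2 hx3
  rw [hx2] at hx1
  rw [hx3, hx2]
  by_cases hx : c x = 1
  · simp [hx]
  · have h0 : c x = 0 := by
      by_contra h0
      exact hx (mul_left_cancel₀ h0 (by rw [← hx1, mul_one]))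
    simp [h0]

/-- On a standard Borel space, an isometry of `L₂` that is multiplicative on `L_∞` is the
composition operator of a measure-preserving map. -/
theorem exists_measurePreserving_of_isMultiplicativeL2 [StandardBorelSpace X] [Nonempty X]
    (hn : ∀ f, ‖T f‖ = ‖f‖) (h1 : T (Lp.const 2 μ 1) = Lp.const 2 μ 1)
    (hT : IsMultiplicativeL2 T) (hinf : ∀ f ∈ boundedL2 μ, T f ∈ boundedL2 μ) :
    ∃ (φ : X → X) (hφ : MeasurePreserving φ μ μ), ∀ f, T f = Lp.compMeasurePreserving φ hφ f := by
  -- Code the points of `X` by binary sequences: `e` embeds `X` into Cantor space and `g` is a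
  -- measurable left inverse. The code of the image point is `k`, whose `n`-th digit is the set `B
  -- n` that `T` assigns to the `n`-th cylinder; the map sought is `g ∘ k`.
  obtain ⟨e, he, hei⟩ := MeasurableSpace.measurable_injection_nat_bool_of_countablySeparated X
  have hemb : MeasurableEmbedding e := he.measurableEmbedding hei
  obtain ⟨g, hg, hge⟩ := hemb.exists_measurable_extend measurable_id fun _ => inferInstance
  have hA : ∀ n : ℕ, MeasurableSet (e ⁻¹' ((fun b : ℕ → Bool => b n) ⁻¹' {true})) := fun n =>
    he (measurable_pi_apply n (measurableSet_singleton true))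
  choose B hB using fun n => exists_mapsIndicator hT hinf (hA n)
  classical
  let k : X → ℕ → Bool := fun x n => decide (x ∈ B n)
  have huniv : MapsIndicator T Set.univ Set.univ :=
    ⟨.univ, .univ, by rw [indicatorConstLp_univ, h1]⟩
  -- The sets whose `e`- and `k`-preimages correspond under `T` form a σ-algebra; it contains the
  -- cylinders, hence all Borel sets.
  let m : MeasurableSpace (ℕ → Bool) :=
    { MeasurableSet' := fun S => MapsIndicator T (e ⁻¹' S) (k ⁻¹' S)
      measurableSet_empty := by simpa using huniv.compl h1
      measurableSet_compl := fun S hS => hS.compl h1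
      measurableSet_iUnion := fun S hS => by
        simpa only [Set.preimage_iUnion] using MapsIndicator.iUnion h1 hT hS }
  have hm : (MeasurableSpace.pi : MeasurableSpace (ℕ → Bool)) ≤ m := by
    refine iSup_le fun n => ?_
    rw [← measurable_iff_comap_le]
    refine @measurable_to_bool _ m _ ?_
    have e1 : k ⁻¹' ((fun b : ℕ → Bool => b n) ⁻¹' {true}) = B n := by
      ext x
      simp [k]
    change MapsIndicator T _ _
    rw [e1]
    exact hB n
  have hφ : ∀ A, MeasurableSet A → MapsIndicator T A ((g ∘ k) ⁻¹' A) := by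
    intro A hA
    have h2 : MapsIndicator T (e ⁻¹' (g ⁻¹' A)) (k ⁻¹' (g ⁻¹' A)) := hm _ (hg hA)
    rw [← Set.preimage_comp, hge] at h2
    exact h2
  have hmp : MeasurePreserving (g ∘ k) μ μ := by
    -- `MapsIndicator` carries the measurability of its target set. Equality of measures comes from
    -- `T` being isometric on indicators.
    have hmeas : Measurable (g ∘ k) := fun A hA => (hφ A hA).2.1
    refine ⟨hmeas, Measure.ext fun A hA => ?_⟩
    obtain ⟨_, hA', h2⟩ := hφ A hA
    have h3 := congrArg norm h2
    rw [hn, norm_indicatorConstLp (by simp) (by simp), norm_indicatorConstLp (by simp) (by simp),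
      norm_one, one_mul, one_mul] at h3
    have h4 := Real.rpow_left_injOn (x := 1 / (2 : ℝ≥0∞).toReal) (by simp) measureReal_nonneg
      measureReal_nonneg h3
    rw [Measure.map_apply hmeas hA]
    exact ((measureReal_eq_measureReal_iff).1 h4).symm
  refine ⟨g ∘ k, hmp, fun f => ?_⟩
  refine Lp.induction (by simp)
    (motive := fun f => T f = Lp.compMeasurePreserving (g ∘ k) hmp f) ?_ ?_ ?_ f
  · intro c s hs hμs
    obtain ⟨_, hs', h2⟩ := hφ s hs
    rw [Lp.simpleFunc.coe_indicatorConst, Lp.indicatorConstLp_compMeasurePreserving]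
    rw [indicatorConstLp_eq_smul hs, indicatorConstLp_eq_smul hs', map_smul, h2]
  · intro f g hf hg _ h2 h3
    rw [map_add, map_add, h2, h3]
  · exact isClosed_eq T.continuous (Lp.isometry_compMeasurePreserving hmp).continuous

end PointRealization

/-! ### Koopman operators -/

section Koopman

variable {X : Type*} [MeasurableSpace X] {μ : Measure X}

/-- The Koopman operator `f ↦ f ∘ φ` on `L₂`. -/
noncomputable def koopmanL2 {φ : X → X} (hφ : MeasurePreserving φ μ μ) : Lp ℂ 2 μ →L[ℂ] Lp ℂ 2 μ :=
  (Lp.compMeasurePreservingₗᵢ ℂ φ hφ).toContinuousLinearMap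

theorem coeFn_koopmanL2 {φ : X → X} (hφ : MeasurePreserving φ μ μ) (f : Lp ℂ 2 μ) :
    koopmanL2 hφ f =ᵐ[μ] f ∘ φ :=
  Lp.coeFn_compMeasurePreserving f hφ

theorem norm_koopmanL2 {φ : X → X} (hφ : MeasurePreserving φ μ μ) (f : Lp ℂ 2 μ) :
    ‖koopmanL2 hφ f‖ = ‖f‖ :=
  Lp.norm_compMeasurePreserving f hφ

theorem koopmanL2_mulL {φ : X → X} (hφ : MeasurePreserving φ μ μ) (b : Lp ℂ ∞ μ) (u : Lp ℂ 2 μ) :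
    koopmanL2 hφ (mulL μ b u) = mulL μ (Lp.compMeasurePreserving φ hφ b) (koopmanL2 hφ u) := by
  apply Lp.ext
  filter_upwards [coeFn_mulL (Lp.compMeasurePreserving φ hφ b) (koopmanL2 hφ u),
    Lp.coeFn_compMeasurePreserving b hφ, coeFn_koopmanL2 hφ (mulL μ b u), coeFn_koopmanL2 hφ u,
    hφ.quasiMeasurePreserving.ae_eq_comp (coeFn_mulL b u)] with x h1 h2 h3 h4 h5
  rw [h1, h2, h3, h4, h5]
  rfl

theorem inner_mulL_left (b : Lp ℂ ∞ μ) (f g : Lp ℂ 2 μ) :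
    inner ℂ (mulL μ b f) g = inner ℂ f (mulL μ (star b) g) := by
  rw [L2.inner_def, L2.inner_def]
  refine integral_congr_ae ?_
  filter_upwards [coeFn_mulL b f, coeFn_mulL (star b) g, Lp.coeFn_star b] with x h1 h2 h3
  rw [h1, h2, h3]
  simp [mul_comm, mul_left_comm]

variable [IsFiniteMeasure μ]

theorem ofLinfty_compMeasurePreserving {φ : X → X} (hφ : MeasurePreserving φ μ μ)
    (b : Lp ℂ ∞ μ) :
    ofLinfty μ (Lp.compMeasurePreserving φ hφ b) = koopmanL2 hφ (ofLinfty μ b) := by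
  apply Lp.ext
  filter_upwards [coeFn_ofLinfty (Lp.compMeasurePreserving φ hφ b),
    Lp.coeFn_compMeasurePreserving b hφ, coeFn_koopmanL2 hφ (ofLinfty μ b),
    hφ.quasiMeasurePreserving.ae_eq_comp (coeFn_ofLinfty b)] with x h1 h2 h3 h4
  rw [h1, h2, h3, h4]

theorem coeFn_constLp_one (p : ℝ≥0∞) : Lp.const p μ (1 : ℂ) =ᵐ[μ] fun _ => 1 :=
  Lp.coeFn_const (p := p) (μ := μ) (1 : ℂ)

theorem mulL_const_one (f : Lp ℂ 2 μ) : mulL μ (Lp.const ∞ μ 1) f = f := by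
  apply Lp.ext
  filter_upwards [coeFn_mulL (Lp.const ∞ μ 1) f, coeFn_constLp_one (μ := μ) ∞] with x h1 h2
  rw [h1, h2, one_mul]

theorem ofLinfty_const_one : ofLinfty μ (Lp.const ∞ μ 1) = Lp.const 2 μ 1 :=
  mulL_const_one _

/-- If multiplication by `b` is isometric on `L₂`, then `b` is unimodular. -/
theorem ae_norm_eq_one_of_isometric {b : Lp ℂ ∞ μ} (h : ∀ f, ‖mulL μ b f‖ = ‖f‖) :
    ∀ᵐ x ∂μ, ‖b x‖ = 1 := by
  -- By polarization an isometric multiplication preserves inner products; testing against `1` gives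
  -- `|b|² = 1`.
  have h1 : mulL μ (star b) (ofLinfty μ b) = Lp.const 2 μ 1 := by
    refine ext_inner_left ℂ fun f => ?_
    rw [← inner_mulL_left]
    exact (LinearIsometry.mk (mulL μ b).toLinearMap h).inner_map_map f (Lp.const 2 μ 1)
  have h2 := coeFn_mulL (star b) (ofLinfty μ b)
  rw [h1] at h2
  filter_upwards [h2, coeFn_ofLinfty b, Lp.coeFn_star b, coeFn_constLp_one (μ := μ) 2]
    with x h2 h3 h4 h5
  rw [h5, h3, h4, Pi.star_apply] at h2
  have h6 := congrArg norm h2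
  rw [norm_mul, norm_star, norm_one] at h6
  nlinarith [norm_nonneg (b x)]

end Koopman

/-! ### Weights and Koopman parts of weighted Koopman groups -/

section WeightedKoopman

variable {X : Type*} [MeasurableSpace X] {μ : Measure X} [IsFiniteMeasure μ]
  {U V : ℝ → Lp ℂ 2 μ →L[ℂ] Lp ℂ 2 μ}

/-- If a `C₀`-group consists of Koopman operators, then its generator is a derivation on the algebra
of the bounded functions in its domain. -/
theorem IsC0Group.generator_isDerivationOn_of_koopman (hV : IsC0Group V) {T : ℝ → X → X}
    (hT : ∀ t, MeasurePreserving (T t) μ μ) (hVT : ∀ t, V t = koopmanL2 (hT t)) :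
    IsFunctionAlgebra ((groupGenerator V).domain ⊓ boundedL2 μ) ∧
      IsDerivationOn (groupGenerator V) ((groupGenerator V).domain ⊓ boundedL2 μ) := by
  have key : ∀ (F G : Lp ℂ ∞ μ) (f' g' : Lp ℂ 2 μ), HasGeneratorAt V (ofLinfty μ F) f' →
      HasGeneratorAt V (ofLinfty μ G) g' →
      HasGeneratorAt V (mulL μ F (ofLinfty μ G)) (mulL μ G f' + mulL μ F g') := by
    intro F G f' g' hf hg
    refine (hV.tendsto_slope_mulL hf hg (W := fun t => Lp.compMeasurePreserving (T t) (hT t) F)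
      (C := ‖F‖) (fun t => ?_) (Eventually.of_forall fun t => ?_)).congr fun t => ?_
    · rw [hVT, ofLinfty_compMeasurePreserving]
    · rw [Lp.norm_compMeasurePreserving]
    · rw [hVT, koopmanL2_mulL]
  have hmul : ∀ F G : Lp ℂ ∞ μ, mulL μ F (ofLinfty μ G) =ᵐ[μ]
      fun x => ofLinfty μ F x * ofLinfty μ G x := fun F G => by
    filter_upwards [coeFn_mulL F (ofLinfty μ G), coeFn_ofLinfty F] with x h1 h2
    rw [h1, h2]
  refine ⟨?_, inf_le_left, ?_⟩
  · rintro _ ⟨⟨f', hf⟩, hfb⟩ _ ⟨⟨g', hg⟩, hgb⟩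
    obtain ⟨F, rfl⟩ := mem_boundedL2_iff.1 hfb
    obtain ⟨G, rfl⟩ := mem_boundedL2_iff.1 hgb
    exact ⟨_, Submodule.mem_inf.2 ⟨⟨_, key F G f' g' hf hg⟩, mulL_mem_boundedL2 F hgb⟩, hmul F G⟩
  · rintro ⟨f, hfd⟩ ⟨g, hgd⟩ ⟨h, hhd⟩ hf hg hh hfg
    obtain ⟨F, rfl⟩ := mem_boundedL2_iff.1 (Submodule.mem_inf.1 hf).2
    obtain ⟨G, rfl⟩ := mem_boundedL2_iff.1 (Submodule.mem_inf.1 hg).2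
    have e : h = mulL μ F (ofLinfty μ G) := Lp.ext (hfg.trans (hmul F G).symm)
    subst e
    have h1 := (hasGeneratorAt_groupGenerator ⟨_, hhd⟩).unique
      (key F G _ _ (hasGeneratorAt_groupGenerator ⟨_, hfd⟩) (hasGeneratorAt_groupGenerator ⟨_, hgd⟩))
    rw [h1]
    filter_upwards [Lp.coeFn_add (mulL μ G (groupGenerator V ⟨_, hfd⟩))
      (mulL μ F (groupGenerator V ⟨_, hgd⟩)), coeFn_mulL G (groupGenerator V ⟨_, hfd⟩),
      coeFn_mulL F (groupGenerator V ⟨_, hgd⟩), coeFn_ofLinfty F, coeFn_ofLinfty G]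
      with x h1 h2 h3 h4 h5
    rw [h1, Pi.add_apply, h2, h3, h4, h5, mul_comm (G x)]

/-- A unitary weighted Koopman group has unimodular weights, and its Koopman operators form a unitary
`C₀`-group. -/
theorem IsWeightedComposition.isUnitaryC0Group_koopman (hU : IsUnitaryC0Group U)
    (hUinf : PreservesLInfty U) {T : ℝ → X → X} {ψ : ℝ → X → ℂ}
    (hUT : IsWeightedComposition U T ψ) (hT : ∀ t, MeasurePreserving (T t) μ μ) :
    (∀ t : ℝ, ∀ᵐ x ∂μ, ‖U t (Lp.const 2 μ (1 : ℂ)) x‖ = 1) ∧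
      IsUnitaryC0Group (fun t => koopmanL2 (hT t)) ∧
      ∀ t f, U t f =ᵐ[μ] fun x => U t (Lp.const 2 μ (1 : ℂ)) x * koopmanL2 (hT t) f x := by
  have hU' := hU.toIsC0Group
  have hconst : Lp.const 2 μ (1 : ℂ) ∈ boundedL2 μ :=
    ofLinfty_const_one (μ := μ) ▸ ofLinfty_mem_boundedL2 _
  choose P hP using fun t => mem_boundedL2_iff.1 (hUinf t _ hconst)
  have hψ : ∀ t, P t =ᵐ[μ] ψ t := fun t => by
    have h1 := hUT t (fun _ => 1) (memLp_const 1)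
    rw [MemLp.toLp_const, ← hP] at h1
    filter_upwards [h1, coeFn_ofLinfty (P t)] with x h1 h2
    rw [← h2, h1, mul_one]
  have hUP : ∀ t f, U t f = mulL μ (P t) (koopmanL2 (hT t) f) := fun t f => by
    have h1 := hUT t f (Lp.memLp f)
    rw [Lp.toLp_coeFn] at h1
    apply Lp.ext
    filter_upwards [h1, hψ t, coeFn_mulL (P t) (koopmanL2 (hT t) f), coeFn_koopmanL2 (hT t) f]
      with x h1 h2 h3 h4
    rw [h1, h3, h2, h4, Function.comp_apply]
  have hadd : ∀ s t f, mulL μ (P (s + t)) (koopmanL2 (hT (s + t)) f) =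
      mulL μ (P s) (mulL μ (Lp.compMeasurePreserving (T s) (hT s) (P t))
        (koopmanL2 (hT s) (koopmanL2 (hT t) f))) := fun s t f => by
    rw [← hUP, hU'.add_apply, hUP t, hUP s, koopmanL2_mulL]
  have hk1 : ∀ t, koopmanL2 (hT t) (Lp.const 2 μ 1) = Lp.const 2 μ 1 := fun t => by
    apply Lp.ext
    filter_upwards [coeFn_koopmanL2 (hT t) (Lp.const 2 μ 1), coeFn_constLp_one (μ := μ) 2,
      (hT t).quasiMeasurePreserving.ae_eq_comp (coeFn_constLp_one (μ := μ) 2)] with x h1 h2 h3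
    rw [h1, h3, h2]
    rfl
  have hcocycle : ∀ s t, ∀ᵐ x ∂μ, P (s + t) x =
      P s x * Lp.compMeasurePreserving (T s) (hT s) (P t) x := fun s t => by
    have h1 := hadd s t (Lp.const 2 μ 1)
    rw [hk1, hk1, hk1] at h1
    have h2 := coeFn_mulL (P (s + t)) (Lp.const 2 μ 1)
    rw [h1] at h2
    filter_upwards [h2, coeFn_constLp_one (μ := μ) 2,
      coeFn_mulL (P s) (mulL μ (Lp.compMeasurePreserving (T s) (hT s) (P t)) (Lp.const 2 μ 1)),
      coeFn_mulL (Lp.compMeasurePreserving (T s) (hT s) (P t)) (Lp.const 2 μ 1)] with x h2 h3 h4 h5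
    rw [h4, h5, h3, mul_one, mul_one] at h2
    exact h2.symm
  have hP0 : P 0 =ᵐ[μ] fun _ => 1 := by
    have h1 := hP 0
    rw [hU'.zero_apply] at h1
    have h2 := coeFn_ofLinfty (P 0)
    rw [h1] at h2
    exact h2.symm.trans (coeFn_constLp_one 2)
  have hPne : ∀ t, ∀ᵐ x ∂μ, P t x ≠ 0 := fun t => by
    have h1 := hcocycle t (-t)
    rw [add_neg_cancel] at h1
    filter_upwards [h1, hP0] with x h1 h2 h3
    rw [h2, h3, zero_mul] at h1
    exact one_ne_zero h1
  have hVadd : ∀ s t, koopmanL2 (hT (s + t)) = (koopmanL2 (hT s)).comp (koopmanL2 (hT t)) := by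
    intro s t
    ext1 f
    rw [ContinuousLinearMap.comp_apply]
    apply Lp.ext
    have h2 := coeFn_mulL (P (s + t)) (koopmanL2 (hT (s + t)) f)
    rw [hadd] at h2
    filter_upwards [h2, coeFn_mulL (P s) (mulL μ (Lp.compMeasurePreserving (T s) (hT s) (P t))
        (koopmanL2 (hT s) (koopmanL2 (hT t) f))),
      coeFn_mulL (Lp.compMeasurePreserving (T s) (hT s) (P t))
        (koopmanL2 (hT s) (koopmanL2 (hT t) f)), hcocycle s t, hPne (s + t)] with x h2 h3 h4 h5 h6
    rw [h3, h4, ← mul_assoc, ← h5] at h2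
    exact (mul_left_cancel₀ h6 h2).symm
  have hV0 : koopmanL2 (hT 0) = ContinuousLinearMap.id ℂ (Lp ℂ 2 μ) := by
    ext1 f
    have h1 := hUP 0 f
    rw [hU'.zero_apply] at h1
    have h2 := coeFn_mulL (P 0) (koopmanL2 (hT 0) f)
    rw [← h1] at h2
    apply Lp.ext
    filter_upwards [h2, hP0] with x h2 h3
    rw [ContinuousLinearMap.id_apply, h2, h3, one_mul]
  -- The group law makes `koopmanL2 (hT t)` surjective, so multiplication by `P t` is isometric on
  -- all of `L₂` as the quotient of two isometries.
  have hP1 : ∀ t, ∀ᵐ x ∂μ, ‖P t x‖ = 1 := fun t => ae_norm_eq_one_of_isometric fun f => by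
    have h1 := hVadd t (-t)
    rw [add_neg_cancel, hV0] at h1
    have h2 : f = koopmanL2 (hT t) (koopmanL2 (hT (-t)) f) := DFunLike.congr_fun h1 f
    conv_lhs => rw [h2]
    rw [← hUP, hU.norm_apply, norm_koopmanL2]
  have hPnorm : ∀ t, ‖star (P t)‖ ≤ 1 := fun t => by
    refine norm_le_of_ofLinfty_mem_boundedBy zero_le_one ?_
    filter_upwards [hP1 t, coeFn_ofLinfty (star (P t)), Lp.coeFn_star (P t)] with x h1 h2 h3
    rw [h2, h3, Pi.star_apply, norm_star, h1]
  have hstar : ∀ t f, koopmanL2 (hT t) f = mulL μ (star (P t)) (U t f) := fun t f => by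
    rw [hUP]
    apply Lp.ext
    filter_upwards [coeFn_mulL (star (P t)) (mulL μ (P t) (koopmanL2 (hT t) f)),
      coeFn_mulL (P t) (koopmanL2 (hT t) f), Lp.coeFn_star (P t), hP1 t] with x h1 h2 h3 h4
    rw [h1, h2, h3, Pi.star_apply, ← mul_assoc, Complex.star_def, Complex.conj_mul', h4]
    simp
  refine ⟨fun t => ?_, isUnitaryC0Group_of_isometry hV0 hVadd (fun t => norm_koopmanL2 _)
    fun f => ?_, fun t f => ?_⟩
  · filter_upwards [hP1 t, coeFn_ofLinfty (P t)] with x h1 h2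
    rw [← hP, h2, h1]
  · have h1 : Tendsto (fun t => U t f) (𝓝 0) (𝓝 f) := by
      simpa only [hU'.zero_apply] using (hU'.continuous_orbit f).tendsto 0
    -- The weights converge to `1` in `L₂` only, but with `L_∞`-norm at most `1`, so `tendsto_mulL`
    -- gives strong continuity at `0`.
    have h2 : Tendsto (fun t => ofLinfty μ (star (P t))) (𝓝 0)
        (𝓝 (ofLinfty μ (Lp.const ∞ μ 1))) := by
      have h3 := tendsto_iff_norm_sub_tendsto_zero.1
        ((hU'.continuous_orbit (Lp.const 2 μ 1)).tendsto 0)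
      rw [hU'.zero_apply] at h3
      refine tendsto_iff_norm_sub_tendsto_zero.2
        (squeeze_zero (fun t => norm_nonneg _) (fun t => ?_) h3)
      rw [← hP, ofLinfty_const_one]
      refine Lp.norm_le_norm_of_ae_le ?_
      filter_upwards [Lp.coeFn_sub (ofLinfty μ (star (P t))) (Lp.const 2 μ (1 : ℂ)),
        Lp.coeFn_sub (ofLinfty μ (P t)) (Lp.const 2 μ (1 : ℂ)), coeFn_ofLinfty (P t),
        coeFn_ofLinfty (star (P t)), Lp.coeFn_star (P t), coeFn_constLp_one (μ := μ) 2]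
        with x h4 h5 h6 h7 h8 h9
      rw [h4, h5, Pi.sub_apply, Pi.sub_apply, h6, h7, h8, h9, Pi.star_apply, ← star_one,
        ← star_sub, norm_star, star_one]
    have h3 := tendsto_mulL (C := 1) (Eventually.of_forall hPnorm) h2 h1
    rw [mulL_const_one] at h3
    exact h3.congr fun t => (hstar t f).symm
  · rw [hUP]
    filter_upwards [coeFn_mulL (P t) (koopmanL2 (hT t) f), coeFn_ofLinfty (P t)] with x h1 h2
    rw [h1, ← hP, h2]

end WeightedKoopman

theorem corollary3p7 {X : Type*} [MeasurableSpace X] [StandardBorelSpace X]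
    (μ : Measure X) [IsProbabilityMeasure μ]
    (U : ℝ → Lp ℂ 2 μ →L[ℂ] Lp ℂ 2 μ) (hU : IsUnitaryC0Group U) (hUinf : PreservesLInfty U) :
    IsWeightedKoopman U ↔
      (∀ t : ℝ, ∀ᵐ x ∂μ, ‖U t (Lp.const 2 μ (1 : ℂ)) x‖ = 1) ∧
      ∃ V : ℝ → Lp ℂ 2 μ →L[ℂ] Lp ℂ 2 μ,
        (∀ (t : ℝ) (f : Lp ℂ 2 μ),
          V t f =ᵐ[μ] fun x => (starRingEnd ℂ) (U t (Lp.const 2 μ (1 : ℂ)) x) * U t f x) ∧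
        IsUnitaryC0Group V ∧
        IsFunctionAlgebra ((groupGenerator V).domain ⊓ boundedL2 μ) ∧
        IsDerivationOn (groupGenerator V) ((groupGenerator V).domain ⊓ boundedL2 μ) := by
  constructor
  · rintro ⟨T, ψ, hUT, hT⟩
    obtain ⟨h1, hV, hUV⟩ := hUT.isUnitaryC0Group_koopman hU hUinf hT
    refine ⟨h1, _, fun t f => ?_, hV,
      hV.toIsC0Group.generator_isDerivationOn_of_koopman hT fun t => rfl⟩
    filter_upwards [h1 t, hUV t f] with x h2 h3
    rw [h3, ← mul_assoc, Complex.conj_mul', h2]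
    simp
  · rintro ⟨h1, V, hVU, hV, halg, hder⟩
    have hconst : Lp.const 2 μ (1 : ℂ) ∈ boundedL2 μ :=
      ofLinfty_const_one (μ := μ) ▸ ofLinfty_mem_boundedL2 _
    have hVinf : PreservesLInfty V := fun t f hf => by
      have hp : MemLp (U t (Lp.const 2 μ (1 : ℂ))) ∞ μ := hUinf t _ hconst
      have hf' : MemLp (U t f) ∞ μ := hUinf t f hf
      have h2 : MemLp (fun x => (starRingEnd ℂ) (U t (Lp.const 2 μ (1 : ℂ)) x) * U t f x) ∞ μ :=
        hf'.mul hp.star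
      exact (memLp_congr_ae (hVU t f)).2 h2
    have hV1 : ∀ t, V t (Lp.const 2 μ 1) = Lp.const 2 μ 1 := fun t => by
      apply Lp.ext
      filter_upwards [hVU t (Lp.const 2 μ 1), h1 t, coeFn_constLp_one (μ := μ) 2] with x h2 h3 h4
      rw [h2, h4, Complex.conj_mul', h3]
      simp
    have : Nonempty X := nonempty_of_isProbabilityMeasure μ
    choose T hT hVT using fun t => exists_measurePreserving_of_isMultiplicativeL2
      (hV.norm_apply t) (hV1 t) (hVinf.map_mulL_of_isDerivationOn hV halg hder t) (hVinf t)
    -- With weight `U_t 1`, unimodularity undoes the conjugate factor in `V`: `U_t 1 · V_t f = |U_t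
    -- 1|² U_t f = U_t f`.
    refine ⟨T, fun t => U t (Lp.const 2 μ 1), fun t f hf => ?_, hT⟩
    have h2 := hVU t (hf.toLp f)
    rw [hVT, Lp.toLp_compMeasurePreserving hf (hT t)] at h2
    filter_upwards [h1 t, h2, (hf.comp_measurePreserving (hT t)).coeFn_toLp] with x h3 h4 h5
    rw [h5, Function.comp_apply] at h4
    rw [h4, ← mul_assoc, Complex.mul_conj', h3]
    simp
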